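/- Let $m=2^{\ell-1}$ with $\ell>1$, and let $G=SD_{4m}=\langle a,b\mid a^{2m}=b^2=e,\ bab=a^{m-1}\rangle$ be the semidihedral group of order $4m$. Let $S\subseteq G\setminus\{e\}$ be inverse-closed and let $\Gamma=\mathrm{Cay}(G,S)$ be the graph with vertex set $G$ in which $x$ and $y$ are adjacent whenever $xy^{-1}\in S$. Suppose that $\Gamma$ is bipartite and distance-regular with diameter $3$; that is, $\Gamma$ is connected of diameter $3$, and for $i=0,1,2,3$ there are constants $b_i,c_i$ such that for all vertices $x,y$ at distance $i$, exactly $b_i$ neighbours of $x$ are at distance $i+1$ from $y$ and exactly $c_i$ neighbours of $x$ are at distance $i-1$ from $y$. Let $H$ be the part of the bipartition of $\Gamma$ that contains the identity element $e$. Then $H$ is a subgroup of $G$, and $G$ is a semidirect product $H\rtimes\mathbb{Z}_2$: for some action of $\mathbb{Z}_2$ on $H$ there is a group isomorphism $f:G\to H\rtimes\mathbb{Z}_2$ that restricts to the canonical embedding on $H$. In particular, $f(S)$ is a connection set (inverse-closed and without the identity), and $f$ is a graph isomorphism from $\Gamma$ onto the Cayley graph $\mathrm{Cay}(H\rtimes\mathbb{Z}_2,f(S))$.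 -/

import Mathlib

/-- The defining relators `a ^ (2 * m)`, `b ^ 2` and `(b * a * b) * (a ^ (m - 1))⁻¹` of the
semidihedral group, as words in the free group on `a = FreeGroup.of 0`, `b = FreeGroup.of 1`. -/
def semidihedralRels (m : ℕ) : Set (FreeGroup (Fin 2)) :=
  {FreeGroup.of 0 ^ (2 * m), FreeGroup.of 1 ^ 2,
    FreeGroup.of 1 * FreeGroup.of 0 * FreeGroup.of 1 * (FreeGroup.of 0 ^ (m - 1))⁻¹}

/-- `⟨a, b ∣ a ^ (2 * m) = b ^ 2 = e, b * a * b = a ^ (m - 1)⟩`. For `m = 2 ^ (ℓ - 1)` with `ℓ > 1`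
this is the semidihedral group of order `4 * m`. -/
abbrev SemidihedralGroup (m : ℕ) : Type := PresentedGroup (semidihedralRels m)

/-- A connection set of a group: inverse-closed, and not containing the identity. -/
structure IsConnectionSet {G : Type*} [Group G] (S : Set G) : Prop where
  one_notMem : (1 : G) ∉ S
  inv_mem : ∀ s ∈ S, s⁻¹ ∈ S

/-- The Cayley graph `Cay(G, S)` of a connection set `S`: `x` and `y` are adjacent whenever
`x * y⁻¹ ∈ S`. -/
def cayleyGraph {G : Type*} [Group G] (S : Set G) (hS : IsConnectionSet S) : SimpleGraph G where
  Adj x y := x * y⁻¹ ∈ S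
  symm := ⟨fun x y h => by simpa using hS.inv_mem _ h⟩
  loopless := ⟨fun x h => hS.one_notMem (by simpa using h)⟩

/-- `Γ` is a connected graph of diameter `d` which is distance-regular: there are numbers
`b i`, `c i` such that whenever `x` and `y` are at distance `i ≤ d`, exactly `b i` neighbours of `x`
are at distance `i + 1` from `y` and exactly `c i` neighbours of `x` are at distance `i - 1`
from `y` (none if `i = 0`). -/
def IsDistanceRegularOfDiam {V : Type*} (Γ : SimpleGraph V) (d : ℕ) : Prop :=
  Γ.Connected ∧ Γ.diam = d ∧
    ∃ b c : ℕ → ℕ, ∀ i ≤ d, ∀ x y : V, Γ.dist x y = i →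
      {z | Γ.Adj x z ∧ Γ.dist z y = i + 1}.encard = (b i : ℕ∞) ∧
      {z | Γ.Adj x z ∧ Γ.dist z y + 1 = i}.encard = (c i : ℕ∞)

/-- `(P, Q)` is a bipartition of `Γ`: the vertex set is the disjoint union of the two parts `P` and
`Q`, and each edge joins a vertex of `P` to a vertex of `Q`. -/
def IsBipartition {V : Type*} (Γ : SimpleGraph V) (P Q : Set V) : Prop :=
  P ∪ Q = Set.univ ∧ Γ.IsBipartiteWith P Q

/-! Right translations are automorphisms of the connected graph, so they respect its bipartition;
hence the part `H` of the identity is a subgroup, of index 2 because odd distances occur. It remains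
to find an involution outside `H`, which splits the extension.

If `b ∉ H`, take `b`. Otherwise `a ∉ H`, and this case is impossible. In the group ring, `S² = k + c
(H - 1)` with `k` the valency and `c = c₂`, so any representation sending some element of `H` to
`-1` kills the sum over `H` and sends `S` to a square root of `k - c` (`sum_sq_of_card_eq`). A
linear character shows that `k - c` is the square of an integer; a two-dimensional representation
turns this integer, up to sign, into an odd polynomial in a root of unity `ζ` conjugate to `-ζ`, so
it is 0 (`eq_of_card_eq`). But `k = c₂` contradicts diameter 3 (`not_forall_encard_eq_degree`). -/

theorem exists_mulEquiv_semidirectProduct {G : Type*} [Group G] (H : Subgroup G)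
    (hH : H.index = 2) (t : G) (ht : t ∉ H) (ht2 : t * t = 1) :
    ∃ (φ : Multiplicative (ZMod 2) →* MulAut H)
      (f : G ≃* SemidirectProduct H (Multiplicative (ZMod 2)) φ),
      ∀ h : H, f (h : G) = SemidirectProduct.inl h := by
  have : H.Normal := Subgroup.normal_of_index_eq_two hH
  let ι : Multiplicative (ZMod 2) →* G := AddMonoidHom.toMultiplicativeLeft
    (ZMod.lift 2 ⟨zmultiplesHom (Additive G) (Additive.ofMul t), by
      simp only [zmultiplesHom_apply]
      rw [← ofMul_zpow]
      exact congrArg Additive.ofMul ((zpow_two t).trans ht2)⟩)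
  have hι : ι (Multiplicative.ofAdd 1) = t := by
    have h1 : (1 : ZMod 2) = ((1 : ℤ) : ZMod 2) := by simp
    simp only [ι, AddMonoidHom.toMultiplicativeLeft_apply_apply, toAdd_ofAdd]
    rw [h1, ZMod.lift_coe]
    simp
  have cases2 : ∀ z : Multiplicative (ZMod 2), z = 1 ∨ z = Multiplicative.ofAdd 1 := by decide
  let f₀ : SemidirectProduct H (Multiplicative (ZMod 2))
      ((MulAut.conjNormal (H := H)).comp ι) →* G :=
    SemidirectProduct.lift H.subtype ι (by
      intro g
      ext h
      simp)
  have hinj : Function.Injective f₀ := by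
    rw [injective_iff_map_eq_one]
    rintro ⟨h, z⟩ hz
    have hz' : (h : G) * ι z = 1 := by simpa [f₀, SemidirectProduct.lift] using hz
    rcases cases2 z with rfl | rfl
    · ext
      · simpa using hz'
      · rfl
    · rw [hι] at hz'
      exact absurd ((Subgroup.mul_mem_cancel_left H h.2).1 (hz' ▸ H.one_mem)) ht
  have hsurj : Function.Surjective f₀ := by
    intro g
    by_cases hg : g ∈ H
    · exact ⟨SemidirectProduct.inl ⟨g, hg⟩, by simp [f₀]⟩
    · refine ⟨⟨⟨g * t, ?_⟩, Multiplicative.ofAdd 1⟩, ?_⟩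
      · rw [Subgroup.mul_mem_iff_of_index_two hH]
        tauto
      · simp [f₀, SemidirectProduct.lift, hι, mul_assoc, ht2]
  refine ⟨_, (MulEquiv.ofBijective f₀ ⟨hinj, hsurj⟩).symm, fun h => ?_⟩
  rw [MulEquiv.symm_apply_eq]
  change _ = f₀ _
  simp [f₀]

/-! ### Bipartitions and distances in Cayley graphs -/

section Cayley

variable {G : Type*} [Group G] {S : Set G} {hS : IsConnectionSet S}

theorem cayleyGraph_adj {x y : G} : (cayleyGraph S hS).Adj x y ↔ x * y⁻¹ ∈ S := Iff.rfl

theorem mem_iff_notMem_of_adj {V : Type*} {Γ : SimpleGraph V} {P Q : Set V}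
    (h : IsBipartition Γ P Q) {x y : V} (hxy : Γ.Adj x y) : x ∈ P ↔ y ∉ P := by
  have hd := Set.disjoint_left.1 h.2.disjoint
  rcases h.2.mem_of_adj hxy with ⟨h1, h2⟩ | ⟨h1, h2⟩
  · exact iff_of_true h1 fun h3 => hd h3 h2
  · exact iff_of_false (fun h3 => hd h3 h1) (by simpa using h2)

theorem walk_mem_iff_even {V : Type*} {Γ : SimpleGraph V} {P Q : Set V}
    (h : IsBipartition Γ P Q) {x y : V} (p : Γ.Walk x y) :
    (x ∈ P ↔ y ∈ P) ↔ Even p.length := by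
  induction p with
  | nil => simp
  | cons hadj p ih =>
    have := mem_iff_notMem_of_adj h hadj
    rw [SimpleGraph.Walk.length_cons, Nat.even_add_one, ← ih]
    tauto

theorem mem_iff_even_dist {V : Type*} {Γ : SimpleGraph V} {P Q : Set V}
    (h : IsBipartition Γ P Q) (hc : Γ.Connected) (x y : V) :
    (x ∈ P ↔ y ∈ P) ↔ Even (Γ.dist x y) := by
  obtain ⟨p, hp⟩ := hc.exists_walk_length_eq_dist x y
  rw [← hp, walk_mem_iff_even h p]

/-- Right multiplication by `g` preserves adjacency, so both memberships flip at each step of a walk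
from `x` to 1. -/
theorem mul_mem_iff_of_isBipartition {P Q : Set G} (h : IsBipartition (cayleyGraph S hS) P Q)
    (hone : (1 : G) ∈ P) (hc : (cayleyGraph S hS).Connected) (x g : G) :
    x * g ∈ P ↔ (x ∈ P ↔ g ∈ P) := by
  obtain ⟨p⟩ := hc x 1
  have key : ∀ {x y : G} (p : (cayleyGraph S hS).Walk x y),
      (x * g ∈ P ↔ y * g ∈ P) ↔ (x ∈ P ↔ y ∈ P) := by
    intro x y p
    induction p with
    | nil => simp
    | cons hadj p ih =>
      rename_i u v w
      have h1 := mem_iff_notMem_of_adj h hadj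
      have h2 : u * g ∈ P ↔ v * g ∉ P :=
        mem_iff_notMem_of_adj h (by simpa [cayleyGraph_adj, mul_assoc] using hadj)
      tauto
  have := key p
  rw [one_mul] at this
  tauto

theorem exists_subgroup_of_isBipartition {P Q : Set G}
    (h : IsBipartition (cayleyGraph S hS) P Q)
    (hone : (1 : G) ∈ P) (hc : (cayleyGraph S hS).Connected) :
    ∃ H : Subgroup G, (H : Set G) = P := by
  have hm := mul_mem_iff_of_isBipartition h hone hc
  refine ⟨⟨⟨⟨P, fun {x y} hx hy => ?_⟩, hone⟩, fun {x} hx => ?_⟩, rfl⟩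
  · rw [hm]; exact iff_of_true hx hy
  · have := hm x x⁻¹
    rw [mul_inv_cancel] at this
    exact (this.1 hone).1 hx

theorem not_forall_encard_eq_degree {V : Type*} {Γ : SimpleGraph V} {k : ℕ}
    (hc : Γ.Connected) (hdiam : Γ.diam = 3)
    (hk : ∀ x, {z | Γ.Adj x z}.encard = k)
    (hk2 : ∀ x y, Γ.dist x y = 2 → {z | Γ.Adj x z ∧ Γ.dist z y + 1 = 2}.encard = k) : False := by
  have := hc.nonempty
  obtain ⟨x, y, hxy⟩ := Γ.exists_dist_eq_diam
  rw [hdiam] at hxy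
  have hall : ∀ u v, Γ.dist u v = 2 → ∀ z, Γ.Adj u z → Γ.Adj z v := by
    intro u v huv z hz
    have hsub : {z | Γ.Adj u z ∧ Γ.dist z v + 1 = 2} ⊆ {z | Γ.Adj u z} := fun z hz => hz.1
    have hfin : {z | Γ.Adj u z}.Finite := Set.finite_of_encard_eq_coe (hk u)
    have heq := (hfin.subset hsub).eq_of_subset_of_encard_le hsub ((hk u).trans (hk2 u v huv).symm).le
    have hz' : z ∈ {z | Γ.Adj u z ∧ Γ.dist z v + 1 = 2} := by rw [heq]; exact hz
    exact SimpleGraph.dist_eq_one_iff_adj.1 (by have := hz'.2; omega)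
  obtain ⟨p, hp⟩ := hc.exists_walk_length_eq_dist x y
  rw [hxy] at hp
  -- On a geodesic `x, x₁, x₂, y`, the vertices `x₂` and `x` are at distance 2, so the neighbour `y`
  -- of `x₂` would be adjacent to `x`.
  match p, hp with
  | .cons (v := x₁) h1 (.cons (v := x₂) h2 (.cons h3 .nil)), _ =>
    have d1 := SimpleGraph.dist_eq_one_iff_adj.2 h3
    have d2 : Γ.dist x x₂ ≤ 2 := SimpleGraph.dist_le (.cons h1 (.cons h2 .nil))
    have d3 := hc.dist_triangle (u := x) (v := x₂) (w := y)
    have h4 := hall x₂ x (by rw [SimpleGraph.dist_comm]; omega) y h3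
    have := SimpleGraph.dist_eq_one_iff_adj.2 h4.symm
    omega

end Cayley

/-! ### The group ring identity under a representation -/

theorem sum_sq_of_card_eq {G R : Type*} [Group G] [Fintype G] [DecidableEq G] [Ring R]
    (T : Finset G) (H : Subgroup G) [DecidablePred (· ∈ H)] (k c : ℕ)
    (hT : ∀ g, (T.filter fun z => g * z⁻¹ ∈ T).card = if g = 1 then k else if g ∈ H then c else 0)
    (ρ : G →* R) (h₀ : G) (h₀H : h₀ ∈ H) (hρ : ρ h₀ = -1) (h2 : ∀ r : R, r = -r → r = 0) :
    (∑ s ∈ T, ρ s) * (∑ s ∈ T, ρ s) = (k : R) - c := by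
  -- Translation by `h₀` permutes `H` and negates the sum.
  have hH : ∑ g, (if g ∈ H then ρ g else 0) = 0 := by
    refine h2 _ ?_
    refine (Equiv.sum_comp (Equiv.mulLeft h₀) _).symm.trans ?_
    rw [← Finset.sum_neg_distrib]
    refine Finset.sum_congr rfl fun g _ => ?_
    simp only [Equiv.coe_mulLeft, H.mul_mem_cancel_left h₀H, map_mul, hρ]
    split_ifs <;> simp
  have h1 : (∑ s ∈ T, ρ s) * (∑ s ∈ T, ρ s)
      = ∑ g, ((T.filter fun z => g * z⁻¹ ∈ T).card : R) * ρ g := by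
    calc (∑ s ∈ T, ρ s) * (∑ s ∈ T, ρ s) = ∑ t ∈ T, ∑ s ∈ T, ρ (s * t) := by
          rw [Finset.sum_mul_sum, Finset.sum_comm]
          simp only [map_mul]
      _ = ∑ t ∈ T, ∑ g, if g * t⁻¹ ∈ T then ρ g else 0 := by
          refine Finset.sum_congr rfl fun t _ => ?_
          rw [← Equiv.sum_comp (Equiv.mulRight t)]
          simp
      _ = _ := by
          rw [Finset.sum_comm]
          refine Finset.sum_congr rfl fun g _ => ?_
          rw [← Finset.sum_filter, Finset.sum_const, nsmul_eq_mul]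
  have h3 : ∀ g, ((T.filter fun z => g * z⁻¹ ∈ T).card : R) * ρ g
      = (if g = 1 then ((k : R) - c) else 0) + c * (if g ∈ H then ρ g else 0) := by
    intro g
    rw [hT]
    by_cases hg : g = 1
    · simp [hg, H.one_mem]
    · by_cases hg' : g ∈ H <;> simp [hg, hg']
  rw [h1, Finset.sum_congr rfl fun g _ => h3 g, Finset.sum_add_distrib, ← Finset.mul_sum, hH]
  simp

/-! ### Normal forms in the semidihedral group -/

namespace SemidihedralGroup

/-- The generator `a` of order `2 * m`. -/
def a (m : ℕ) : SemidihedralGroup m := PresentedGroup.of 0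

/-- The generator `b` of order two. -/
def b (m : ℕ) : SemidihedralGroup m := PresentedGroup.of 1

variable {m : ℕ}

theorem a_pow : a m ^ (2 * m) = 1 :=
  PresentedGroup.one_of_mem (rels := semidihedralRels m) (Or.inl rfl)

theorem b_mul_b : b m * b m = 1 := by
  rw [← pow_two]
  exact PresentedGroup.one_of_mem (rels := semidihedralRels m) (Or.inr (Or.inl rfl))

theorem b_mul_a_mul_b : b m * a m * b m = a m ^ (m - 1) :=
  mul_inv_eq_one.1
    (PresentedGroup.one_of_mem (rels := semidihedralRels m) (Or.inr (Or.inr rfl)))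

theorem b_mul_a_pow (n : ℕ) : b m * a m ^ n = a m ^ ((m - 1) * n) * b m := by
  have h : b m * a m ^ n * (b m)⁻¹ = a m ^ ((m - 1) * n) := by
    rw [← conj_pow, pow_mul, ← b_mul_a_mul_b, inv_eq_of_mul_eq_one_right b_mul_b]
  rw [← h, inv_mul_cancel_right]

/-- The homomorphism determined by the images of the two generators. -/
def lift {M : Type*} [Group M] (x y : M) (h1 : x ^ (2 * m) = 1) (h2 : y ^ 2 = 1)
    (h3 : y * x * y = x ^ (m - 1)) : SemidihedralGroup m →* M :=
  PresentedGroup.toGroup (f := ![x, y]) (by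
    rintro r (rfl | rfl | rfl)
    · simpa using h1
    · simpa using h2
    · simpa [mul_inv_eq_one] using h3)

section
variable {M : Type*} [Group M] {x y : M} (h1 : x ^ (2 * m) = 1) (h2 : y ^ 2 = 1)
    (h3 : y * x * y = x ^ (m - 1))

theorem lift_a : lift x y h1 h2 h3 (a m) = x := by simp [lift, a]

theorem lift_b : lift x y h1 h2 h3 (b m) = y := by simp [lift, b]
end

theorem exists_eq_pow (hm : 0 < m) (g : SemidihedralGroup m) :
    ∃ n < 2 * m, g = a m ^ n ∨ g = a m ^ n * b m := by
  have hmod : ∀ n, a m ^ n = a m ^ (n % (2 * m)) := fun n => by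
    conv_lhs => rw [← Nat.mod_add_div n (2 * m), pow_add, pow_mul, a_pow, one_pow, mul_one]
  suffices h : ∃ n, g = a m ^ n ∨ g = a m ^ n * b m by
    obtain ⟨n, hn⟩ := h
    exact ⟨n % (2 * m), Nat.mod_lt _ (by omega), by rwa [← hmod]⟩
  have ha : ∀ g, (∃ n, g = a m ^ n ∨ g = a m ^ n * b m) →
      ∃ n, a m * g = a m ^ n ∨ a m * g = a m ^ n * b m := by
    rintro g ⟨n, rfl | rfl⟩
    · exact ⟨n + 1, Or.inl (pow_succ' _ _).symm⟩
    · exact ⟨n + 1, Or.inr (by rw [pow_succ', mul_assoc])⟩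
  have hb : ∀ g, (∃ n, g = a m ^ n ∨ g = a m ^ n * b m) →
      ∃ n, b m * g = a m ^ n ∨ b m * g = a m ^ n * b m := by
    rintro g ⟨n, rfl | rfl⟩
    · exact ⟨_, Or.inr (b_mul_a_pow n)⟩
    · exact ⟨_, Or.inl (by rw [← mul_assoc, b_mul_a_pow, mul_assoc, b_mul_b, mul_one])⟩
  have hapow : ∀ j g, (∃ n, g = a m ^ n ∨ g = a m ^ n * b m) →
      ∃ n, a m ^ j * g = a m ^ n ∨ a m ^ j * g = a m ^ n * b m := by
    intro j
    induction j with
    | zero => simp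
    | succ j ih =>
      intro g hg
      rw [pow_succ', mul_assoc]
      exact ha _ (ih g hg)
  have hainv : (a m)⁻¹ = a m ^ (2 * m - 1) := by
    rw [inv_eq_iff_mul_eq_one, ← pow_succ', Nat.sub_add_cancel (by omega), a_pow]
  have hg : g ∈ Subgroup.closure (Set.range (PresentedGroup.of (rels := semidihedralRels m))) := by
    rw [PresentedGroup.closure_range_of]; trivial
  induction hg using Subgroup.closure_induction_left with
  | one => exact ⟨0, Or.inl (pow_zero _).symm⟩
  | mul_left x hx y hy ih =>
    obtain ⟨i, rfl⟩ := hx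
    fin_cases i
    · exact ha _ ih
    · exact hb _ ih
  | inv_mul_cancel x hx y hy ih =>
    obtain ⟨i, rfl⟩ := hx
    fin_cases i
    · change ∃ n, (a m)⁻¹ * y = a m ^ n ∨ (a m)⁻¹ * y = a m ^ n * b m
      rw [hainv]
      exact hapow _ _ ih
    · change ∃ n, (b m)⁻¹ * y = a m ^ n ∨ (b m)⁻¹ * y = a m ^ n * b m
      rw [inv_eq_of_mul_eq_one_right b_mul_b]
      exact hb _ ih

theorem finite (hm : 0 < m) : Finite (SemidihedralGroup m) := by
  refine Finite.of_surjective
    (fun p : Fin (2 * m) × Bool => if p.2 then a m ^ (p.1 : ℕ) else a m ^ (p.1 : ℕ) * b m) ?_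
  intro g
  obtain ⟨n, hn, rfl | rfl⟩ := exists_eq_pow hm g
  · exact ⟨(⟨n, hn⟩, true), by simp⟩
  · exact ⟨(⟨n, hn⟩, false), by simp⟩

end SemidihedralGroup

/-! ### Representations and the equality `k = c` -/

namespace SemidihedralGroup

variable {m : ℕ} {ζ : ℂ}

theorem diag_pow (x y : ℂ) (n : ℕ) :
    (!![x, 0; 0, y] : Matrix (Fin 2) (Fin 2) ℂ) ^ n = !![x ^ n, 0; 0, y ^ n] := by
  induction n with
  | zero => simp [Matrix.one_fin_two]
  | succ n ih => rw [pow_succ, ih]; simp [pow_succ]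

/-- The image of `a` in the two-dimensional representation attached to `ζ`. -/
noncomputable def rotationMatrix (ζ : ℂ) (hζ : ζ ≠ 0) : (Matrix (Fin 2) (Fin 2) ℂ)ˣ where
  val := !![ζ, 0; 0, -ζ⁻¹]
  inv := !![ζ⁻¹, 0; 0, -ζ]
  val_inv := by simp [hζ, Matrix.one_fin_two]
  inv_val := by simp [hζ, Matrix.one_fin_two]

/-- The image of `b` in the two-dimensional representations. -/
def swapMatrix : (Matrix (Fin 2) (Fin 2) ℂ)ˣ where
  val := !![0, 1; 1, 0]
  inv := !![0, 1; 1, 0]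
  val_inv := by simp [Matrix.one_fin_two]
  inv_val := by simp [Matrix.one_fin_two]

theorem exists_representation (hm : Even m) (hm0 : 0 < m) (hζ0 : ζ ≠ 0) (hζ : ζ ^ m = -1) :
    ∃ ρ : SemidihedralGroup m →* Matrix (Fin 2) (Fin 2) ℂ,
      (∀ n, ρ (a m ^ n) = !![ζ ^ n, 0; 0, (-ζ⁻¹) ^ n]) ∧
      ∀ n, ρ (a m ^ n * b m) = !![0, ζ ^ n; (-ζ⁻¹) ^ n, 0] := by
  have hζ' : (-ζ⁻¹) ^ m = -1 := by rw [hm.neg_pow, inv_pow, hζ]; norm_num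
  have h1 : rotationMatrix ζ hζ0 ^ (2 * m) = 1 := by
    ext1
    rw [Units.val_pow_eq_pow_val, rotationMatrix, diag_pow, mul_comm, pow_mul, pow_mul, hζ, hζ']
    simp [Matrix.one_fin_two]
  have h2 : swapMatrix ^ 2 = 1 := by
    ext1
    simp [swapMatrix, pow_two, Matrix.one_fin_two]
  have h4 : ζ ^ (m - 1) = -ζ⁻¹ := by
    have : ζ ^ (m - 1) * ζ = -1 := by rw [← pow_succ, Nat.sub_add_cancel hm0, hζ]
    field_simp
    exact this
  have h5 : (-ζ⁻¹) ^ (m - 1) = ζ := by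
    rw [(Nat.Even.sub_odd hm0 hm odd_one).neg_pow, inv_pow, h4]
    simp
  have h3 : swapMatrix * rotationMatrix ζ hζ0 * swapMatrix = rotationMatrix ζ hζ0 ^ (m - 1) := by
    ext1
    rw [Units.val_pow_eq_pow_val, rotationMatrix, diag_pow, h4, h5]
    simp [swapMatrix]
  have ha : ∀ n, ((Units.coeHom _).comp (lift _ _ h1 h2 h3)) (a m ^ n)
      = !![ζ ^ n, 0; 0, (-ζ⁻¹) ^ n] := fun n => by
    rw [map_pow, MonoidHom.comp_apply, lift_a]
    exact diag_pow _ _ _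
  refine ⟨(Units.coeHom _).comp (lift _ _ h1 h2 h3), ha, fun n => ?_⟩
  rw [map_mul, ha, MonoidHom.comp_apply, lift_b]
  simp [swapMatrix]

theorem a_pow_mem_iff {H : Subgroup (SemidihedralGroup m)} (hH : H.index = 2)
    (ha : a m ∉ H) (n : ℕ) : a m ^ n ∈ H ↔ Even n := by
  induction n with
  | zero => simp [H.one_mem]
  | succ n ih =>
    rw [pow_succ, Subgroup.mul_mem_iff_of_index_two hH, ih, Nat.even_add_one]
    tauto

/-- `ζ` and `-ζ` share a cyclotomic minimal polynomial, so `q` takes the integer value `v` at both;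
oddness gives `v = -v`. -/
theorem _root_.Polynomial.int_eq_zero_of_aeval_eq_of_odd {n : ℕ} {ζ : ℂ}
    (hζ : IsPrimitiveRoot ζ n) (hζ' : IsPrimitiveRoot (-ζ) n) (hn : 0 < n)
    (q : Polynomial ℤ) (hq : Polynomial.aeval (-ζ) q = -Polynomial.aeval ζ q) (v : ℤ)
    (hv : Polynomial.aeval ζ q = (v : ℂ)) : v = 0 := by
  have h0 : Polynomial.aeval ζ (q - Polynomial.C v) = 0 := by simp [hv]
  have h1 := minpoly.isIntegrallyClosed_dvd (hζ.isIntegral hn) h0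
  rw [← Polynomial.cyclotomic_eq_minpoly hζ hn, Polynomial.cyclotomic_eq_minpoly hζ' hn] at h1
  have h2 : Polynomial.aeval (-ζ) (q - Polynomial.C v) = 0 := by
    obtain ⟨r, hr⟩ := h1
    rw [hr, map_mul, minpoly.aeval, zero_mul]
  rw [map_sub, hq, hv, Polynomial.aeval_C] at h2
  have h3 : (((-v - v : ℤ)) : ℂ) = 0 := by push_cast; exact h2
  have := Int.cast_eq_zero.1 h3
  omega

theorem eq_of_card_eq [Fintype (SemidihedralGroup m)] [DecidableEq (SemidihedralGroup m)]
    (hm : Even m) (hm0 : 0 < m) (H : Subgroup (SemidihedralGroup m)) (hH : H.index = 2)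
    [DecidablePred (· ∈ H)] (ha : a m ∉ H) (hb : b m ∈ H)
    (T : Finset (SemidihedralGroup m)) (hTH : ∀ s ∈ T, s ∉ H) (hTi : ∀ s ∈ T, s⁻¹ ∈ T) (k c : ℕ)
    (hT : ∀ g, (T.filter fun z => g * z⁻¹ ∈ T).card =
      if g = 1 then k else if g ∈ H then c else 0) : k = c := by
  set ζ : ℂ := Complex.exp (2 * Real.pi * Complex.I / (2 * m : ℕ)) with hζdef
  have hζ : IsPrimitiveRoot ζ (2 * m) := Complex.isPrimitiveRoot_exp _ (by omega)
  have hζ0 : ζ ≠ 0 := Complex.exp_ne_zero _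
  have hζm : ζ ^ m = -1 := (hζ.pow (by omega) (mul_comm 2 m)).eq_neg_one_of_two_right
  -- `-ζ = ζ ^ (m + 1)`, and `m + 1` is odd, hence prime to `2 * m`.
  have hζ' : IsPrimitiveRoot (-ζ) (2 * m) := by
    have h := hζ.pow_of_coprime (m + 1) (by
      refine Nat.Coprime.mul_right ?_ (by simp)
      exact (Nat.coprime_two_right).2 hm.add_one)
    rwa [pow_succ, hζm, neg_one_mul] at h
  obtain ⟨ρ, hρa, hρb⟩ := exists_representation hm hm0 hζ0 hζm
  have form : ∀ s ∈ T, ∃ n, Odd n ∧ (s = a m ^ n ∨ s = a m ^ n * b m) := by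
    intro s hs
    obtain ⟨n, -, h⟩ := exists_eq_pow hm0 s
    refine ⟨n, ?_, h⟩
    have := hTH s hs
    rw [← Nat.not_even_iff_odd, ← a_pow_mem_iff hH ha]
    rcases h with rfl | rfl
    · exact this
    · rwa [H.mul_mem_cancel_right hb] at this
  have hρm : ρ (a m ^ m) = -1 := by
    rw [hρa, hζm, hm.neg_pow, inv_pow, hζm]
    ext i j
    fin_cases i <;> fin_cases j <;> norm_num [Matrix.one_fin_two]
  have hM := sum_sq_of_card_eq T H k c hT ρ (a m ^ m) ((a_pow_mem_iff hH ha m).2 hm) hρm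
    fun r hr => by
      ext i j
      exact self_eq_neg.1 (congrFun (congrFun hr i) j)
  set M := ∑ s ∈ T, ρ s with hMdef
  -- Inversion permutes `T` and negates this entry: it vanishes on powers of `a`, and for odd `n`
  -- the image of `a ^ n * b` squares to `-1`.
  have hM01 : M 0 1 = 0 := by
    refine self_eq_neg.1 ?_
    simp only [hMdef, Matrix.sum_apply]
    rw [← Finset.sum_neg_distrib]
    refine Finset.sum_nbij' (·⁻¹) (·⁻¹) hTi hTi (by simp) (by simp) fun s hs => ?_
    have hinv : ρ s * ρ s⁻¹ = 1 := by rw [← map_mul, mul_inv_cancel, map_one]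
    obtain ⟨n, hn, rfl | rfl⟩ := form s hs
    · have h01 := congrFun (congrFun hinv 0) 1
      rw [hρa] at h01
      simp [Matrix.mul_apply, hζ0] at h01
      rw [h01, hρa]
      simp
    · have hsq : ρ (a m ^ n * b m) * ρ (a m ^ n * b m) = -1 := by
        rw [hρb]
        ext i j
        fin_cases i <;> fin_cases j <;>
          simp [Matrix.mul_apply, Matrix.one_fin_two, hn.neg_pow, hζ0]
      have : ρ (a m ^ n * b m)⁻¹ = -ρ (a m ^ n * b m) := by
        calc _ = -(-1 * ρ (a m ^ n * b m)⁻¹) := by simp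
          _ = _ := by rw [← hsq, mul_assoc, hinv, mul_one]
      rw [this]
      simp
  have hM00 : M 0 0 * M 0 0 = (k : ℂ) - c := by
    have h := congrFun (congrFun hM 0) 0
    rw [Matrix.mul_apply, Fin.sum_univ_two, hM01, zero_mul, add_zero] at h
    rw [h, ← Matrix.diagonal_natCast, ← Matrix.diagonal_natCast]
    simp
  -- The character `a ↦ 1`, `b ↦ -1` is usable since `b ∈ H`.
  let χ : SemidihedralGroup m →* ℤ :=
    (Units.coeHom ℤ).comp (lift (1 : ℤˣ) (-1) (one_pow _) (by simp) (by simp))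
  have hχ : χ (b m) = -1 := by
    simp only [χ, MonoidHom.comp_apply, lift_b]
    simp
  have hu := sum_sq_of_card_eq T H k c hT χ (b m) hb hχ fun r hr => by omega
  set u := ∑ s ∈ T, χ s
  obtain ⟨v, hv, hvu⟩ : ∃ v : ℤ, M 0 0 = v ∧ v * v = u * u := by
    have h : M 0 0 * M 0 0 = (u : ℂ) * u := by
      rw [hM00]
      exact_mod_cast congrArg (Int.cast : ℤ → ℂ) hu.symm
    rcases mul_self_eq_mul_self_iff.1 h with h | h
    · exact ⟨u, h, rfl⟩
    · exact ⟨-u, by rw [h]; push_cast; rfl, neg_mul_neg _ _⟩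
  have hq : ∀ s : SemidihedralGroup m, ∃ q : Polynomial ℤ, s ∈ T →
      Polynomial.aeval ζ q = ρ s 0 0 ∧
        Polynomial.aeval (-ζ) q = -Polynomial.aeval ζ q := by
    intro s
    by_cases hs : s ∈ T
    · obtain ⟨n, hn, rfl | rfl⟩ := form s hs
      · exact ⟨Polynomial.X ^ n, fun _ => by simp [hρa, hn.neg_pow]⟩
      · exact ⟨0, fun _ => by simp [hρb]⟩
    · exact ⟨0, fun h => absurd h hs⟩
  choose q hq using hq
  have hv0 : v = 0 := by
    refine Polynomial.int_eq_zero_of_aeval_eq_of_odd hζ hζ' (by omega) (∑ s ∈ T, q s) ?_ v ?_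
    · rw [map_sum, map_sum, ← Finset.sum_neg_distrib]
      exact Finset.sum_congr rfl fun s hs => (hq s hs).2
    · rw [map_sum, ← hv, hMdef, Matrix.sum_apply]
      exact Finset.sum_congr rfl fun s hs => (hq s hs).1
  rw [← hvu, hv0, mul_zero] at hu
  have : (k : ℤ) = c := by simpa using sub_eq_zero.1 hu.symm
  exact_mod_cast this

end SemidihedralGroup

/-! ### The involution outside `H` and the main theorem -/

open SemidihedralGroup in
theorem exists_involution_notMem {m : ℕ} (hm : Even m) (hm0 : 0 < m)
    (S : Set (SemidihedralGroup m)) (hS : IsConnectionSet S)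
    (P Q : Set (SemidihedralGroup m)) (hbip : IsBipartition (cayleyGraph S hS) P Q)
    (hdr : IsDistanceRegularOfDiam (cayleyGraph S hS) 3)
    (H : Subgroup (SemidihedralGroup m)) (hHP : (H : Set (SemidihedralGroup m)) = P)
    (hH : H.index = 2) : ∃ t, t ∉ H ∧ t * t = 1 := by
  classical
  by_cases hb : b m ∈ H
  swap
  · exact ⟨b m, hb, b_mul_b⟩
  obtain ⟨hc, hdiam, β, γ, hreg⟩ := hdr
  set Γ := cayleyGraph S hS with hΓ
  have memP : ∀ x, x ∈ P ↔ x ∈ H := fun x => by rw [← hHP]; rfl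
  have hfin := SemidihedralGroup.finite hm0
  have := Fintype.ofFinite (SemidihedralGroup m)
  have ha : a m ∉ H := by
    intro ha
    have htop : H = ⊤ := by
      rw [eq_top_iff]
      intro g _
      obtain ⟨n, -, rfl | rfl⟩ := exists_eq_pow hm0 g
      · exact H.pow_mem ha n
      · exact H.mul_mem (H.pow_mem ha n) hb
    rw [htop, Subgroup.index_top] at hH
    omega
  have hadjS : ∀ z, Γ.Adj 1 z ↔ z ∈ S := fun z => by
    rw [SimpleGraph.adj_comm]
    simp [hΓ, cayleyGraph_adj]
  have hdeg : ∀ x, {z | Γ.Adj x z}.encard = β 0 := by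
    intro x
    rw [← (hreg 0 (by norm_num) x x SimpleGraph.dist_self).1]
    congr 1
    ext z
    simp only [Set.mem_ofPred_eq, zero_add, SimpleGraph.dist_eq_one_iff_adj]
    exact ⟨fun h => ⟨h, h.symm⟩, fun h => h.1⟩
  have hcard : ∀ g, ((S.toFinset.filter fun z => g * z⁻¹ ∈ S.toFinset).card : ℕ∞)
      = {z | Γ.Adj 1 z ∧ Γ.Adj z g}.encard := by
    intro g
    rw [← Set.encard_coe_eq_coe_finsetCard]
    congr 1
    ext z
    have h : Γ.Adj z g ↔ g * z⁻¹ ∈ S := SimpleGraph.adj_comm _ z g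
    simp [hadjS, h]
  have hkc : β 0 = γ 2 := by
    refine eq_of_card_eq hm hm0 H hH ha hb S.toFinset (fun s hs => ?_) (fun s hs => ?_) _ _
      fun g => ?_
    · rw [Set.mem_toFinset, ← hadjS] at hs
      have := mem_iff_notMem_of_adj hbip hs
      rw [memP, memP] at this
      exact this.1 H.one_mem
    · rw [Set.mem_toFinset] at hs ⊢
      exact hS.inv_mem s hs
    · have hpar := mem_iff_even_dist hbip hc 1 g
      rw [memP, memP, iff_true_left H.one_mem] at hpar
      split_ifs with h1 h2
      · subst h1
        refine ENat.natCast_inj.1 ((hcard 1).trans ?_)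
        rw [← hdeg 1]
        congr 1
        ext z
        exact ⟨fun h => h.1, fun h => ⟨h, h.symm⟩⟩
      -- `diam` is 0 by default when distances are unbounded; the value 3 excludes this.
      · have hle : Γ.dist 1 g ≤ 3 := hdiam ▸ SimpleGraph.dist_le_diam
          (SimpleGraph.ediam_ne_top_of_diam_ne_zero (by rw [hdiam]; norm_num))
        have hpos := hc.pos_dist_of_ne (Ne.symm h1)
        have hd : Γ.dist 1 g = 2 := by
          obtain ⟨r, hr⟩ := hpar.1 h2
          omega
        refine ENat.natCast_inj.1 ((hcard g).trans ?_)
        rw [← (hreg 2 (by norm_num) 1 g hd).2]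
        congr 1
        ext z
        simp [← SimpleGraph.dist_eq_one_iff_adj]
      · refine ENat.natCast_inj.1 ((hcard g).trans ?_)
        rw [Nat.cast_zero, Set.encard_eq_zero, Set.eq_empty_iff_forall_notMem]
        rintro z ⟨hz1, hz2⟩
        have e1 := mem_iff_notMem_of_adj hbip hz1
        have e2 := mem_iff_notMem_of_adj hbip hz2
        simp only [memP] at e1 e2
        have := H.one_mem
        tauto
  exact (not_forall_encard_eq_degree hc hdiam hdeg fun x y hxy =>
    hkc ▸ (hreg 2 (by norm_num) x y hxy).2).elim

theorem proposition5p5 (l m : ℕ) (hl : 1 < l) (hm : m = 2 ^ (l - 1))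
    (S : Set (SemidihedralGroup m)) (hS : IsConnectionSet S)
    (P Q : Set (SemidihedralGroup m))
    (hbip : IsBipartition (cayleyGraph S hS) P Q)
    (hone : (1 : SemidihedralGroup m) ∈ P)
    (hdr : IsDistanceRegularOfDiam (cayleyGraph S hS) 3) :
    ∃ H : Subgroup (SemidihedralGroup m), (H : Set (SemidihedralGroup m)) = P ∧
      ∃ (φ : Multiplicative (ZMod 2) →* MulAut H)
        (f : SemidihedralGroup m ≃* SemidirectProduct H (Multiplicative (ZMod 2)) φ),
        (∀ h : H, f (h : SemidihedralGroup m) = SemidirectProduct.inl h) ∧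
        ∃ hS' : IsConnectionSet (f '' S),
          ∀ x y : SemidihedralGroup m,
            (cayleyGraph S hS).Adj x y ↔ (cayleyGraph (f '' S) hS').Adj (f x) (f y) := by
  have hm0 : 0 < m := by rw [hm]; positivity
  have hme : Even m := by rw [hm]; exact even_two.pow_of_ne_zero (by omega)
  have hc := hdr.1
  obtain ⟨H, hHP⟩ := exists_subgroup_of_isBipartition hbip hone hc
  have memP : ∀ x, x ∈ P ↔ x ∈ H := fun x => by rw [← hHP]; rfl
  have hH : H.index = 2 := by
    obtain ⟨x, y, hxy⟩ := (cayleyGraph S hS).exists_dist_eq_diam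
    rw [hdr.2.1] at hxy
    have hodd := mem_iff_even_dist hbip hc x y
    rw [hxy, memP, memP] at hodd
    have h3 : ¬ Even 3 := by decide
    obtain ⟨g, hg⟩ : ∃ g, g ∉ H := by
      by_contra! hall
      exact h3 (hodd.1 (iff_of_true (hall x) (hall y)))
    rw [Subgroup.index_eq_two_iff]
    refine ⟨g, fun z => ?_⟩
    have := mul_mem_iff_of_isBipartition hbip hone hc z g
    simp only [memP] at this
    rw [xor_iff_iff_not]
    tauto
  obtain ⟨t, ht, ht2⟩ := exists_involution_notMem hme hm0 S hS P Q hbip hdr H hHP hH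
  obtain ⟨φ, f, hf⟩ := exists_mulEquiv_semidirectProduct H hH t ht ht2
  refine ⟨H, hHP, φ, f, hf, ⟨?_, ?_⟩, fun x y => ?_⟩
  · rintro ⟨s, hs, h1⟩
    rw [map_eq_one_iff f f.injective] at h1
    exact hS.one_notMem (h1 ▸ hs)
  · rintro _ ⟨s, hs, rfl⟩
    exact ⟨s⁻¹, hS.inv_mem s hs, map_inv f s⟩
  · rw [cayleyGraph_adj, cayleyGraph_adj, ← map_inv, ← map_mul, f.injective.mem_set_image]
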